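/- Let $d, \eta, p \ge 1$ be integers, let $e := \eta p$ with $e \ge 2$, and let $r := dp$. Identify $\mathbb{Z}/r\mathbb{Z}$ with $\{0,\dots,r-1\}$. Let $\kappa = (\kappa_0,\dots,\kappa_{r-1}) \in (\mathbb{Z}/e\mathbb{Z})^r$ be compatible with $(d,\eta,p)$, that is, $\kappa_{k+d} = \kappa_k + \eta$ for all $k \in \mathbb{Z}/r\mathbb{Z}$. An $r$-partition is an $r$-tuple $\boldsymbol{\lambda} = (\lambda^{(0)},\dots,\lambda^{(r-1)})$ of partitions; its Young diagram $\mathcal{Y}(\boldsymbol{\lambda})$ is the set of nodes $(a,b,c)$ with $0 \le c \le r-1$ and $(a,b)$ in the Young diagram of $\lambda^{(c)}$ (row $a \ge 0$, column $b \ge 0$, $b < \lambda^{(c)}_a$). Let $Q = \bigoplus_{i \in \mathbb{Z}/e\mathbb{Z}} \mathbb{Z}\alpha_i$ be the free $\mathbb{Z}$-module with basis $(\alpha_i)_{i \in \mathbb{Z}/e\mathbb{Z}}$ and $Q^+ = \bigoplus_i \mathbb{N}\alpha_i$. Set $$\alpha_\kappa(\boldsymbol{\lambda}) := \sum_{(a,b,c)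 \in \mathcal{Y}(\boldsymbol{\lambda})} \alpha_{b-a+\kappa_c} \in Q^+ .$$ Let $\sigma : Q \to Q$ be the $\mathbb{Z}$-linear map with $\sigma\cdot\alpha_i = \alpha_{i+\eta}$, and for an $r$-partition put $${}^{\sigma}\boldsymbol{\lambda} := (\lambda^{(r-d)},\dots,\lambda^{(r-1)},\lambda^{(0)},\dots,\lambda^{(r-d-1)}).$$ Theorem. Let $\boldsymbol{\lambda}$ be an $r$-partition and let $\alpha := \alpha_\kappa(\boldsymbol{\lambda})$. If $\sigma\cdot\alpha = \alpha$, then there is an $r$-partition $\boldsymbol{\mu}$ with $\alpha_\kappa(\boldsymbol{\mu}) = \alpha$ and ${}^{\sigma}\boldsymbol{\mu} = \boldsymbol{\mu}$. -/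

import Mathlib

namespace Stuttering

/-- An `r`-partition `(lam⁽⁰⁾, …, lam⁽ʳ⁻¹⁾)`: a family of partitions indexed by `ℤ/rℤ`, which is
identified with `{0, …, r - 1}`. A partition is given by its Young diagram
`{(a, b) : b < lam_a}`, where `a` is the row and `b` is the column; this is Mathlib's
`YoungDiagram` (see `YoungDiagram.equivListRowLens` for the bijection with non-increasing lists of
positive integers). -/
abbrev Multipartition (r : ℕ) : Type := ZMod r → YoungDiagram

/-- A multicharge `(κ₀, …, κ_{r-1}) ∈ (ℤ/eℤ)ʳ`. -/
abbrev Multicharge (e r : ℕ) : Type := ZMod r → ZMod e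

/-- `κ` is compatible with `(d, η, p)`, where `e = η p` and `r = d p`:
`κ_{k + d} = κ_k + η` for all `k ∈ ℤ/rℤ`. -/
def Compatible {e r : ℕ} (κ : Multicharge e r) (d η : ℕ) : Prop :=
  ∀ k : ZMod r, κ (k + (d : ZMod r)) = κ k + (η : ZMod e)

/-- The Young diagram of an `r`-partition: the union over `c` of `Y(lam⁽ᶜ⁾) × {c}`. -/
def diagram {r : ℕ} [NeZero r] (lam : Multipartition r) : Finset ((ℕ × ℕ) × ZMod r) :=
  Finset.univ.biUnion fun c : ZMod r => (lam c).cells ×ˢ {c}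

/-- The `κ`-residue `b - a + κ_c` (in `ℤ/eℤ`) of the node `(a, b, c)`. -/
def residue {e r : ℕ} (κ : Multicharge e r) (γ : (ℕ × ℕ) × ZMod r) : ZMod e :=
  (γ.1.2 : ZMod e) - (γ.1.1 : ZMod e) + κ γ.2

/-- The free `ℤ`-module `Q` with basis `(α_i)`, `i ∈ ℤ/eℤ`. -/
abbrev RootLattice (e : ℕ) : Type := ZMod e →₀ ℤ

/-- The basis element `α_i` of `Q`. -/
noncomputable def simpleRoot {e : ℕ} (i : ZMod e) : RootLattice e := Finsupp.single i 1

/-- `α_κ(lam)`: the sum of `α_{res_κ(γ)}` over the nodes `γ` of the Young diagram of `lam`. -/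
noncomputable def content {e r : ℕ} [NeZero r] (κ : Multicharge e r) (lam : Multipartition r) :
    RootLattice e :=
  ∑ γ ∈ diagram lam, simpleRoot (residue κ γ)

/-- The shift on `Q`: the `ℤ`-linear map with `α_i ↦ α_{i + η}`
(see `rootShift_simpleRoot`). -/
noncomputable def rootShift (e η : ℕ) : RootLattice e →ₗ[ℤ] RootLattice e :=
  Finsupp.lmapDomain ℤ ℤ fun i : ZMod e => i + (η : ZMod e)

theorem rootShift_simpleRoot (e η : ℕ) (i : ZMod e) :
    rootShift e η (simpleRoot i) = simpleRoot (i + (η : ZMod e)) := by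
  simp [rootShift, simpleRoot, Finsupp.mapDomain_single]

/-- The shift on `r`-partitions: `(lam⁽ʳ⁻ᵈ⁾, …, lam⁽ʳ⁻¹⁾, lam⁽⁰⁾, …, lam⁽ʳ⁻ᵈ⁻¹⁾)`, that is, the
component of index `k` of the result is the component of index `k - d` of `lam`. -/
def componentShift {r : ℕ} (d : ℕ) (lam : Multipartition r) : Multipartition r :=
  fun k => lam (k - (d : ZMod r))

end Stuttering

/-! A shift-invariant multipartition repeats one diagram `μ_c` along each of the `d` orbits of
charges `k_c + η j` (`0 ≤ j < p`, `0 ≤ k_c < η`). Its content is then the content modulo `η` of the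
`d`-tuple `(μ_c)` with charges `k_c` (`sum_residueCount_fold`). As `α` is `η`-periodic, it remains
to realise `α`, read modulo `η`, by such a `d`-tuple.

Let `n_j` count the nodes of residue `j` in one diagram and put `x_j = n_j - n_{j+1}`. The abacus
shows that the possible data are exactly the integer vectors `x` of sum zero with `2 n_0 = ∑ x_j² +
2w`, `w ≥ 0` (`sum_sq_residueCount_sub_le`, `exists_residueCount_eq`). After adding the indicator of
`i < k_c`, a `d`-tuple becomes an integer matrix `z` with row sums `k_c` and column sums `Z_i`
prescribed by `α`. It can be realised as soon as `∑ z (z - 1) ≤ 2 α_0`, the excess being absorbed by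
the weight of one component.

The given multipartition yields a larger matrix `u`, indexed by `(c, j)` and `(i, m)`, with each
margin repeated `p` times and `∑ (u² ± u) ≤ 2 α_0`. Averaging `u` would lose integrality, so the two
costs are compared by duality. A least-squares `z` admits integer potentials with `z - π_c - ρ_i ∈
{0, 1}` (`exists_matrix_potentials`). Splitting `π_c` and `ρ_i` by floors into `p` integers each
gives dual variables for `u` with the same dual value (`sum_potential_sq`), and weak duality
concludes (`sum_mul_sub_one_le`). -/

namespace Stuttering

/-! ### Shortest-path potentials in a weighted complete digraph. -/

/-- The total weight of the consecutive steps of a path. -/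
def pathWeight {C : Type*} (V : C → C → ℤ) : List C → ℤ
  | a :: b :: l => V a b + pathWeight V (b :: l)
  | _ => 0

theorem pathWeight_append {C : Type*} (V : C → C → ℤ) (l₁ : List C) (a : C) (l₂ : List C) :
    pathWeight V (l₁ ++ a :: l₂) = pathWeight V (l₁ ++ [a]) + pathWeight V (a :: l₂) := by
  induction l₁ with
  | nil => simp [pathWeight]
  | cons x l ih =>
    cases l with
    | nil => simp [pathWeight]
    | cons y l => simpa [pathWeight, add_assoc] using ih

/-- The cyclic permutation of a list follows its consecutive steps and closes up from the last entry
to the head. Suffixes are used so that the induction keeps the permutation fixed. -/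
theorem sum_drop_formPerm {C : Type*} [DecidableEq C] (V : C → C → ℤ) (x : C) (l : List C)
    (hl : (x :: l).Nodup) (k n : ℕ) (hn : n + k + 1 = (x :: l).length) :
    (((x :: l).drop n).map fun y => V y ((x :: l).formPerm y)).sum =
      pathWeight V ((x :: l).drop n) + V ((x :: l).getLast (by simp)) x := by
  induction k generalizing n with
  | zero =>
    have hn' : n < (x :: l).length := by omega
    rw [List.drop_eq_getElem_cons hn', List.drop_eq_nil_of_le (by omega)]
    have h : (x :: l)[n] = (x :: l).getLast (by simp) := by
      rw [List.getLast_eq_getElem]; congr 1; omega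
    rw [h]
    simp only [List.map_cons, List.map_nil, List.sum_cons, List.sum_nil, pathWeight, zero_add,
      add_zero, List.formPerm_apply_getLast]
  | succ k ih =>
    have hn' : n + 1 < (x :: l).length := by omega
    have h := ih (n + 1) (by omega)
    rw [List.drop_eq_getElem_cons (Nat.lt_of_succ_lt hn')]
    rw [List.map_cons, List.sum_cons, h, List.drop_eq_getElem_cons hn', pathWeight,
      List.formPerm_apply_lt_getElem _ hl n hn', ← add_assoc]

theorem sum_support_formPerm {C : Type*} [DecidableEq C] [Fintype C] (V : C → C → ℤ) (x y : C)
    (l : List C) (hl : (x :: y :: l).Nodup) :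
    ∑ c ∈ (x :: y :: l).formPerm.support, V c ((x :: y :: l).formPerm c) =
      pathWeight V (x :: y :: l) + V ((x :: y :: l).getLast (by simp)) x := by
  rw [List.support_formPerm_of_nodup _ hl (by simp), List.sum_toFinset _ hl]
  exact sum_drop_formPerm V x (y :: l) hl _ 0 (by simp; rfl)

/-- The potential of `c` is the least weight of a simple path starting at `c`; without negative
cycles these satisfy the triangle inequality. -/
theorem exists_potential {C : Type*} [DecidableEq C] [Fintype C] (V : C → C → ℤ)
    (hV : ∀ τ : Equiv.Perm C, 0 ≤ ∑ x ∈ τ.support, V x (τ x)) :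
    ∃ π : C → ℤ, ∀ a b, a ≠ b → π a ≤ V a b + π b := by
  have hmin : ∀ c : C, ∃ l : List C, (c :: l).Nodup ∧
      ∀ l' : List C, (c :: l').Nodup → pathWeight V (c :: l) ≤ pathWeight V (c :: l') := by
    intro c
    have hfin : Finite {l : List C // (c :: l).Nodup} :=
      Finite.of_injective (β := {l : List C // l.Nodup}) (fun l => ⟨c :: l.1, l.2⟩) (by
        intro l l' h
        simpa [Subtype.ext_iff] using h)
    have : Nonempty {l : List C // (c :: l).Nodup} := ⟨⟨[], by simp⟩⟩
    obtain ⟨l, hl⟩ := Finite.exists_min fun l : {l : List C // (c :: l).Nodup} =>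
      pathWeight V (c :: l.1)
    exact ⟨l.1, l.2, fun l' hl' => hl ⟨l', hl'⟩⟩
  choose P hP hPmin using hmin
  refine ⟨fun c => pathWeight V (c :: P c), fun a b hab => ?_⟩
  -- If the optimal path from `b` passes through `a`, then its part up to `a`, closed by the edge
  -- from `a` to `b`, is a nonnegative cycle and can be dropped. Otherwise `a` is prepended to the
  -- path.
  by_cases ha : a ∈ P b
  · obtain ⟨l₁, l₂, h⟩ := List.append_of_mem ha
    have hnd := hP b
    have hsplit := pathWeight_append V (b :: l₁) a l₂
    rw [List.cons_append, ← h] at hsplit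
    rw [h] at hnd
    have h₂ : (a :: l₂).Nodup :=
      hnd.sublist ((List.sublist_append_right l₁ (a :: l₂)).trans (List.sublist_cons_self _ _))
    have h₁ : (b :: (l₁ ++ [a])).Nodup := hnd.sublist (by simp)
    have hcyc : 0 ≤ pathWeight V (b :: (l₁ ++ [a])) + V a b := by
      cases l₁ with
      | nil =>
        have := sum_support_formPerm V b a [] h₁
        have h0 := hV ([b, a].formPerm)
        rw [this] at h0
        simpa using h0
      | cons y l₁ =>
        have := sum_support_formPerm V b y (l₁ ++ [a]) h₁
        have h0 := hV ((b :: y :: (l₁ ++ [a])).formPerm)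
        rw [this] at h0
        simpa using h0
    have := hPmin a l₂ h₂
    simp only [List.cons_append] at hsplit
    linarith
  · have := hPmin a (b :: P b) (List.nodup_cons.2 ⟨by simp [hab, ha], hP b⟩)
    simpa [pathWeight] using this

/-! ### Integer matrices with given margins and least sum of squares. -/

/-- An integer matrix with given margins whose sum of squares is minimal among such matrices has
no negative exchange cycle. -/
theorem exchange_nonneg_of_minimal {C I : Type*} [Fintype C] [Fintype I] [DecidableEq C]
    [DecidableEq I] (z : C → I → ℤ)
    (hmin : ∀ z' : C → I → ℤ, (∀ c, ∑ i, z' c i = ∑ i, z c i) →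
      (∀ i, ∑ c, z' c i = ∑ c, z c i) → ∑ c, ∑ i, z c i ^ 2 ≤ ∑ c, ∑ i, z' c i ^ 2)
    (τ : Equiv.Perm C) (f : C → I) :
    0 ≤ ∑ c ∈ τ.support, (z c (f c) + 1 - z (τ c) (f c)) := by
  have hτ : ∀ c, τ.symm c = c ↔ τ c = c := fun c => by
    rw [Equiv.symm_apply_eq, eq_comm]
  -- For each moved `c`, one unit passes in column `f c` from row `τ c` to row `c`; this preserves
  -- all margins.
  let A : C → I → ℤ := fun c i => if τ c ≠ c ∧ f c = i then 1 else 0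
  let B : C → I → ℤ := fun c i => A (τ.symm c) i
  have hB : ∀ c i, B c i = if τ c ≠ c ∧ f (τ.symm c) = i then 1 else 0 := by
    intro c i
    simp only [B, A, Equiv.apply_symm_apply, ne_eq, eq_comm (a := c), hτ]
  have hA1 : ∀ c, ∑ i, A c i = if τ c ≠ c then 1 else 0 := by
    intro c; by_cases h : τ c = c <;> simp [A, h]
  have hB1 : ∀ c, ∑ i, B c i = if τ c ≠ c then 1 else 0 := by
    intro c; by_cases h : τ c = c <;> simp [hB, h]
  have hcost := hmin (fun c i => z c i + A c i - B c i)
    (fun c => by simp [Finset.sum_add_distrib, Finset.sum_sub_distrib, hA1, hB1])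
    (fun i => by
      have : ∑ c, B c i = ∑ c, A c i := Equiv.sum_comp τ.symm (fun c => A c i)
      simp [Finset.sum_add_distrib, Finset.sum_sub_distrib, this])
  -- Only an inequality: when a row gains and loses in the same column, the true change is `0` while
  -- the bound counts `2`.
  have hrow : ∀ c, ∑ i, (z c i + A c i - B c i) ^ 2 ≤ ∑ i, z c i ^ 2 +
      if τ c ≠ c then 2 * (z c (f c) + 1 - z c (f (τ.symm c))) else 0 := by
    intro c
    have h1 : ∑ i, (z c i + A c i - B c i) ^ 2 ≤
        ∑ i, (z c i ^ 2 + 2 * z c i * A c i - 2 * z c i * B c i + A c i + B c i) := by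
      refine Finset.sum_le_sum fun i _ => ?_
      rw [hB]
      simp only [A]
      split_ifs <;> nlinarith
    refine h1.trans (le_of_eq ?_)
    have h2 : ∑ i, 2 * z c i * A c i = if τ c ≠ c then 2 * z c (f c) else 0 := by
      by_cases h : τ c = c <;> simp [A, h]
    have h3 : ∑ i, 2 * z c i * B c i = if τ c ≠ c then 2 * z c (f (τ.symm c)) else 0 := by
      by_cases h : τ c = c <;> simp [hB, h]
    rw [Finset.sum_add_distrib, Finset.sum_add_distrib, Finset.sum_sub_distrib,
      Finset.sum_add_distrib, h2, h3, hA1, hB1]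
    split_ifs <;> ring
  have hsum := hcost.trans (Finset.sum_le_sum fun c _ => hrow c)
  rw [Finset.sum_add_distrib] at hsum
  have hre : ∑ c, (if τ c ≠ c then z c (f (τ.symm c)) else 0) =
      ∑ c, if τ c ≠ c then z (τ c) (f c) else 0 := by
    rw [← Equiv.sum_comp τ]
    simp
  have hsupp : τ.support = Finset.univ.filter fun c => τ c ≠ c := by ext; simp
  rw [hsupp, Finset.sum_filter]
  have e1 : ∑ c, (if τ c ≠ c then 2 * (z c (f c) + 1 - z c (f (τ.symm c))) else 0) =
      2 * (∑ c, (if τ c ≠ c then z c (f c) + 1 else 0) -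
        ∑ c, if τ c ≠ c then z c (f (τ.symm c)) else 0) := by
    rw [← Finset.sum_sub_distrib, Finset.mul_sum]
    refine Finset.sum_congr rfl fun c _ => ?_
    split_ifs <;> ring
  have e2 : ∑ c, (if τ c ≠ c then z c (f c) + 1 - z (τ c) (f c) else 0) =
      ∑ c, (if τ c ≠ c then z c (f c) + 1 else 0) -
        ∑ c, if τ c ≠ c then z (τ c) (f c) else 0 := by
    rw [← Finset.sum_sub_distrib]
    refine Finset.sum_congr rfl fun c _ => ?_
    split_ifs <;> ring
  rw [e1, hre] at hsum
  rw [e2]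
  linarith

/-- Integer margins are realised by an integer matrix which differs from a matrix of the form
`π c + ρ i` by a matrix with entries in `{0, 1}`. -/
theorem exists_matrix_potentials {C I : Type*} [Fintype C] [Fintype I] [DecidableEq C]
    [DecidableEq I] [Nonempty C] [Nonempty I] (k : C → ℤ) (Z : I → ℤ)
    (hkZ : ∑ c, k c = ∑ i, Z i) :
    ∃ (z : C → I → ℤ) (π : C → ℤ) (ρ : I → ℤ), (∀ c, ∑ i, z c i = k c) ∧
      (∀ i, ∑ c, z c i = Z i) ∧
      ∀ c i, z c i = π c + ρ i ∨ z c i = π c + ρ i + 1 := by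
  obtain ⟨c₀⟩ := ‹Nonempty C›
  obtain ⟨i₀⟩ := ‹Nonempty I›
  let S : Set (C → I → ℤ) := {z | (∀ c, ∑ i, z c i = k c) ∧ ∀ i, ∑ c, z c i = Z i}
  have hS : S.Nonempty := by
    -- Row sums go in column `i₀`, column sums in row `c₀`, and the common total is removed at the
    -- corner.
    refine ⟨fun c i => (if i = i₀ then k c else 0) + (if c = c₀ then Z i else 0) -
      (if c = c₀ then if i = i₀ then ∑ i, Z i else 0 else 0), fun c => ?_, fun i => ?_⟩
    · by_cases h : c = c₀ <;> simp [Finset.sum_add_distrib, h]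
    · by_cases h : i = i₀ <;> simp [Finset.sum_add_distrib, h, hkZ]
  let cost : (C → I → ℤ) → ℕ := fun z => (∑ c, ∑ i, z c i ^ 2).toNat
  obtain ⟨z, ⟨hzk, hzZ⟩, hz⟩ : ∃ z ∈ S, ∀ z' ∈ S, cost z ≤ cost z' :=
    exists_minimalFor_of_wellFoundedLT (· ∈ S) cost hS |>.elim fun z h =>
      ⟨z, h.1, fun z' hz' => (le_total (cost z) (cost z')).elim id fun h' => h.2 hz' h'⟩
  have hmin : ∀ z' : C → I → ℤ, (∀ c, ∑ i, z' c i = ∑ i, z c i) →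
      (∀ i, ∑ c, z' c i = ∑ c, z c i) → ∑ c, ∑ i, z c i ^ 2 ≤ ∑ c, ∑ i, z' c i ^ 2 := by
    intro z' h₁ h₂
    have h := hz z' ⟨fun c => (h₁ c).trans (hzk c), fun i => (h₂ i).trans (hzZ i)⟩
    have h0 : 0 ≤ ∑ c, ∑ i, z' c i ^ 2 :=
      Finset.sum_nonneg fun c _ => Finset.sum_nonneg fun i _ => sq_nonneg _
    simp only [cost] at h
    omega
  have hcol : ∀ a b : C, ∃ i, ∀ i', z a i + 1 - z b i ≤ z a i' + 1 - z b i' := fun a b =>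
    have : Nonempty I := ⟨i₀⟩
    Finite.exists_min fun i => z a i + 1 - z b i
  choose g hg using hcol
  obtain ⟨π, hπ⟩ := exists_potential (fun a b => z a (g a b) + 1 - z b (g a b)) fun τ =>
    exchange_nonneg_of_minimal z hmin τ fun c => g c (τ c)
  have hrow : ∀ i, ∃ c, ∀ c', z c i - π c ≤ z c' i - π c' := fun i =>
    have : Nonempty C := ⟨c₀⟩
    Finite.exists_min fun c => z c i - π c
  choose m hm using hrow
  -- With `ρ i` the minimum of `z c i - π c` over `c`, the potential inequality from the minimising
  -- row to `c` bounds the excess by `1`.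
  refine ⟨z, π, fun i => z (m i) i - π (m i), hzk, hzZ, fun c i => ?_⟩
  have h₁ := hm i c
  beta_reduce
  by_cases hc : m i = c
  · left; rw [hc]; ring
  · have h₂ := hπ (m i) c hc
    have h₃ := hg (m i) c i
    omega

/-! ### First and second moments of the floors of `(n + j) / p`. -/

theorem sum_range_add_emod (n : ℤ) (p : ℕ) (hp : 0 < p) (f : ℤ → ℤ) :
    ∑ j ∈ Finset.range p, f ((n + j) % p) = ∑ j ∈ Finset.range p, f j := by
  have hp' : (0 : ℤ) < p := by exact_mod_cast hp
  refine Finset.sum_bij' (fun j _ => ((n + j) % p).toNat) (fun j _ => ((j - n) % p).toNat)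
    ?_ ?_ ?_ ?_ ?_
  · intro j _
    have := Int.emod_lt_of_pos (n + j) hp'
    have := Int.emod_nonneg (n + j) hp'.ne'
    simp only [Finset.mem_range]; omega
  · intro j _
    have := Int.emod_lt_of_pos (j - n) hp'
    have := Int.emod_nonneg (j - n) hp'.ne'
    simp only [Finset.mem_range]; omega
  · intro j hj
    have := Int.emod_nonneg (n + j) hp'.ne'
    have hj := Finset.mem_range.1 hj
    rw [Int.toNat_of_nonneg this, Int.emod_sub_emod, add_sub_cancel_left,
      Int.emod_eq_of_lt (by omega) (by omega)]
    simp
  · intro j hj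
    have := Int.emod_nonneg (j - n) hp'.ne'
    have hj := Finset.mem_range.1 hj
    rw [Int.toNat_of_nonneg this, Int.add_emod_emod, add_sub_cancel,
      Int.emod_eq_of_lt (by omega) (by omega)]
    simp
  · intro j _
    rw [Int.toNat_of_nonneg (Int.emod_nonneg _ hp'.ne')]

theorem sum_range_add_ediv (n : ℤ) (p : ℕ) (hp : 0 < p) :
    ∑ j ∈ Finset.range p, (n + j) / (p : ℤ) = n := by
  have hp' : (p : ℤ) ≠ 0 := by exact_mod_cast hp.ne'
  refine mul_left_cancel₀ hp' ?_
  have h : ∀ j : ℕ, (p : ℤ) * ((n + j) / p) = n + j - (n + j) % p := fun j => by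
    have := Int.mul_ediv_add_emod (n + j) p; linarith
  rw [Finset.mul_sum, Finset.sum_congr rfl fun j _ => h j, Finset.sum_sub_distrib,
    sum_range_add_emod n p hp fun x => x, Finset.sum_add_distrib]
  simp

theorem sum_range_cast_mul_two (p : ℕ) :
    (∑ j ∈ Finset.range p, (j : ℤ)) * 2 = p * (p - 1) := by
  induction p with
  | zero => simp
  | succ p ih => rw [Finset.sum_range_succ, add_mul, ih]; push_cast; ring

/-- Write `p` times the floor as `n + j` minus its remainder: after completing the square, `j`
enters mainly through the remainders, which are a permutation of `0, …, p - 1`. -/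
theorem sum_range_add_ediv_sq (n : ℤ) (p : ℕ) (hp : 0 < p) :
    ∑ j ∈ Finset.range p, ((p : ℤ) * ((n + j) / p) ^ 2 + (n + j) / p * (p - 2 * j)) =
      n ^ 2 + n := by
  have hp' : (p : ℤ) ≠ 0 := by exact_mod_cast hp.ne'
  refine mul_left_cancel₀ hp' ?_
  have h : ∀ j : ℕ, (p : ℤ) * ((p : ℤ) * ((n + j) / p) ^ 2 + (n + j) / p * (p - 2 * j)) =
      ((n - (n + j) % p) ^ 2 - p * ((n + j) % p)) - ((j : ℤ) ^ 2 - p * j) + p * n := fun j => by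
    have := Int.mul_ediv_add_emod (n + j) p
    set q := (n + j) / (p : ℤ)
    have hr : (n + j) % (p : ℤ) = n + j - p * q := by linarith
    rw [hr]; ring
  rw [Finset.mul_sum, Finset.sum_congr rfl fun j _ => h j, Finset.sum_add_distrib,
    Finset.sum_sub_distrib, sum_range_add_emod n p hp fun x => (n - x) ^ 2 - p * x,
    ← Finset.sum_sub_distrib]
  have h' : ∀ j : ℕ, (n - (j : ℤ)) ^ 2 - p * j - ((j : ℤ) ^ 2 - p * j) = n ^ 2 - n * 2 * j :=
    fun j => by ring
  rw [Finset.sum_congr rfl fun j _ => h' j, Finset.sum_sub_distrib, ← Finset.mul_sum]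
  have := sum_range_cast_mul_two p
  simp only [Finset.sum_const, Finset.card_range, nsmul_eq_mul]
  linear_combination (-n) * this

/-! ### Residue counts read on the abacus. -/

/-- The number of nodes `(a, b)` with `b - a = j` in `ℤ/eℤ`. -/
def residueCount (e : ℕ) (μ : YoungDiagram) (j : ZMod e) : ℤ :=
  ∑ γ ∈ μ.cells, if (γ.2 : ZMod e) - (γ.1 : ZMod e) = j then 1 else 0

/-- The `a`-th element of the beta-set with `N` elements of a Young diagram. -/
def bead (μ : YoungDiagram) (N a : ℕ) : ℕ := μ.rowLen a + (N - 1 - a)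

theorem bead_lt_bead (μ : YoungDiagram) {N a b : ℕ} (hab : a < b) (hb : b < N) :
    bead μ N b < bead μ N a := by
  have := μ.rowLen_anti a b hab.le
  unfold bead
  omega

theorem bead_injOn (μ : YoungDiagram) (N : ℕ) :
    Set.InjOn (bead μ N) (Finset.range N : Set ℕ) := by
  intro a ha b hb h
  simp only [Finset.coe_range, Set.mem_Iio] at ha hb
  rcases lt_trichotomy a b with hab | hab | hab
  · exact absurd h (bead_lt_bead μ hab hb).ne'
  · exact hab
  · exact absurd h (bead_lt_bead μ hab ha).ne

/-- Row `a` telescopes from `N - 1 - a` to its bead, and the starting points exhaust `0, …, N - 1`.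
The choices of `F` below are `t / e` and the indicator of a residue class. -/
theorem sum_cells_eq_sum_bead (μ : YoungDiagram) (N : ℕ) (hN : μ.colLen 0 ≤ N) (F : ℕ → ℤ) :
    ∑ γ ∈ μ.cells, (F (γ.2 + (N - 1 - γ.1) + 1) - F (γ.2 + (N - 1 - γ.1))) =
      ∑ a ∈ Finset.range N, F (bead μ N a) - ∑ a ∈ Finset.range N, F a := by
  rw [Finset.sum_finset_product' μ.cells (Finset.range N) (fun a => Finset.range (μ.rowLen a))
    (f := fun a b => F (b + (N - 1 - a) + 1) - F (b + (N - 1 - a)))]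
  · rw [← Finset.sum_range_reflect F N, ← Finset.sum_sub_distrib]
    refine Finset.sum_congr rfl fun a _ => ?_
    have := Finset.sum_range_sub (fun b => F (b + (N - 1 - a))) (μ.rowLen a)
    simp only [zero_add] at this
    rw [bead, ← this]
    refine Finset.sum_congr rfl fun b _ => ?_
    rw [Nat.add_right_comm]
  · rintro ⟨a, b⟩
    rw [YoungDiagram.mem_cells, YoungDiagram.mem_iff_lt_rowLen, Finset.mem_range, Finset.mem_range]
    refine ⟨fun h => ⟨?_, h⟩, fun h => h.2⟩
    have h' : (a, 0) ∈ μ := YoungDiagram.mem_iff_lt_rowLen.2 (Nat.zero_lt_of_lt h)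
    exact (YoungDiagram.mem_iff_lt_colLen.1 h').trans_le hN

theorem sum_range_mul {M : Type*} [AddCommMonoid M] (f : ℕ → M) (m n : ℕ) :
    ∑ t ∈ Finset.range (m * n), f t =
      ∑ b ∈ Finset.range n, ∑ a ∈ Finset.range m, f (m * b + a) := by
  induction n with
  | zero => simp
  | succ n ih => rw [Nat.mul_succ, Finset.sum_range_add, ih, Finset.sum_range_succ]

theorem sum_zmod_eq_sum_range {M : Type*} [AddCommMonoid M] (e : ℕ) [NeZero e] (f : ZMod e → M) :
    ∑ j : ZMod e, f j = ∑ a ∈ Finset.range e, f (a : ZMod e) := by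
  refine Finset.sum_bij' (fun j _ => j.val) (fun a _ => (a : ZMod e)) ?_ ?_ ?_ ?_ ?_
  · intro j _; exact Finset.mem_range.2 j.val_lt
  · simp
  · intro j _; simp
  · intro a ha; exact ZMod.val_cast_of_lt (Finset.mem_range.1 ha)
  · intro j _; simp

section Beads

variable (e M : ℕ) (μ : YoungDiagram)

/-- Taking a multiple of `e` as number of beads makes positions on the abacus agree with residues of
nodes. -/
theorem cast_cell_shift (hN : μ.colLen 0 ≤ e * M) {γ : ℕ × ℕ} (hγ : γ ∈ μ.cells) :
    ((γ.2 + (e * M - 1 - γ.1) + 1 : ℕ) : ZMod e) = (γ.2 : ZMod e) - γ.1 := by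
  have hlt : γ.1 < e * M := by
    have : (γ.1, 0) ∈ μ := μ.up_left_mem le_rfl (Nat.zero_le _) ((YoungDiagram.mem_cells γ).1 hγ)
    exact (YoungDiagram.mem_iff_lt_colLen.1 this).trans_le hN
  have h : γ.2 + (e * M - 1 - γ.1) + 1 = γ.2 + e * M - γ.1 := by omega
  rw [h, Nat.cast_sub (by omega)]
  simp

variable [NeZero e]

theorem residueCount_zero_eq (hN : μ.colLen 0 ≤ e * M) :
    residueCount e μ 0 * 2 =
      (∑ a ∈ Finset.range (e * M), ((bead μ (e * M) a / e : ℕ) : ℤ)) * 2 - e * (M * (M - 1)) := by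
  have h := sum_cells_eq_sum_bead μ (e * M) hN fun t => ((t / e : ℕ) : ℤ)
  have h₁ : ∑ t ∈ Finset.range (e * M), ((t / e : ℕ) : ℤ) = e * ∑ b ∈ Finset.range M, (b : ℤ) := by
    rw [sum_range_mul, Finset.mul_sum]
    refine Finset.sum_congr rfl fun b _ => ?_
    rw [Finset.sum_congr rfl (g := fun _ => (b : ℤ))]
    · simp
    · intro a ha
      rw [Nat.mul_add_div (NeZero.pos e), Nat.div_eq_of_lt (Finset.mem_range.1 ha), add_zero]
  have h₂ := sum_range_cast_mul_two M
  have h₃ : residueCount e μ 0 = ∑ a ∈ Finset.range (e * M), ((bead μ (e * M) a / e : ℕ) : ℤ) -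
      ∑ t ∈ Finset.range (e * M), ((t / e : ℕ) : ℤ) := by
    rw [← h]
    refine Finset.sum_congr rfl fun γ hγ => ?_
    have hcast := cast_cell_shift e M μ hN hγ
    simp only [Nat.succ_div, ← hcast, ZMod.natCast_eq_zero_iff]
    split_ifs <;> simp
  rw [h₃, h₁]
  linear_combination -(e : ℤ) * h₂

theorem residueCount_sub_eq (hN : μ.colLen 0 ≤ e * M) (j : ZMod e) :
    residueCount e μ j - residueCount e μ (j + 1) =
      (((Finset.range (e * M)).filter fun a => (bead μ (e * M) a : ZMod e) = j).card : ℤ) - M := by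
  have h := sum_cells_eq_sum_bead μ (e * M) hN fun t => if (t : ZMod e) = j then 1 else 0
  have h₁ : ∑ t ∈ Finset.range (e * M), (if (t : ZMod e) = j then (1 : ℤ) else 0) = M := by
    rw [sum_range_mul, Finset.sum_congr rfl (g := fun _ => (1 : ℤ))]
    · simp
    · intro b _
      have := sum_zmod_eq_sum_range e fun i => if i = j then (1 : ℤ) else 0
      simpa using this.symm
  rw [h₁, ← Finset.natCast_card_filter] at h
  rw [← h, residueCount, residueCount, ← Finset.sum_sub_distrib]
  refine Finset.sum_congr rfl fun γ hγ => ?_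
  have hcast := cast_cell_shift e M μ hN hγ
  have hcast' : ((γ.2 + (e * M - 1 - γ.1) : ℕ) : ZMod e) = (γ.2 : ZMod e) - γ.1 - 1 := by
    rw [← hcast]; push_cast; ring
  simp only [hcast, hcast', sub_eq_iff_eq_add (b := (1 : ZMod e))]

end Beads

theorem card_mul_le_sum_of_injOn {ι : Type*} (s : Finset ι) (f : ι → ℕ)
    (hf : Set.InjOn f (s : Set ι)) :
    (s.card : ℤ) * (s.card - 1) ≤ (∑ i ∈ s, (f i : ℤ)) * 2 := by
  have key : ∀ n : ℕ, ∀ T : Finset ℕ, T.card = n →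
      (n : ℤ) * (n - 1) ≤ (∑ t ∈ T, (t : ℤ)) * 2 := by
    intro n
    induction n with
    | zero => intro T hT; simp [Finset.card_eq_zero.1 hT]
    | succ n ih =>
      intro T hT
      have hne : T.Nonempty := Finset.card_pos.1 (by omega)
      have hmax := T.max'_mem hne
      have h := ih (T.erase (T.max' hne)) (by rw [Finset.card_erase_of_mem hmax, hT]; rfl)
      have hle : n ≤ T.max' hne := by
        have hsub : T ⊆ Finset.range (T.max' hne + 1) := fun t ht =>
          Finset.mem_range.2 (Nat.lt_succ_of_le (T.le_max' t ht))
        have := Finset.card_le_card hsub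
        rw [Finset.card_range] at this
        omega
      rw [← Finset.add_sum_erase T _ hmax]
      push_cast
      have : (n : ℤ) ≤ T.max' hne := by exact_mod_cast hle
      linarith
  have := key _ (s.image f) rfl
  rwa [Finset.card_image_of_injOn hf, Finset.sum_image hf] at this

theorem sum_residueCount_sub (e : ℕ) [NeZero e] (μ : YoungDiagram) :
    ∑ j : ZMod e, (residueCount e μ j - residueCount e μ (j + 1)) = 0 := by
  rw [Finset.sum_sub_distrib, sub_eq_zero]
  exact (Equiv.sum_comp (Equiv.addRight (1 : ZMod e)) _).symm

theorem sum_mul_sub_one_eq {ι : Type*} [Fintype ι] (x : ι → ℤ) (hx : ∑ j, x j = 0) (M : ℤ) :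
    ∑ j, (x j + M) * (x j + M - 1) =
      ∑ j, x j ^ 2 + Fintype.card ι * (M * (M - 1)) := by
  have : ∀ j, (x j + M) * (x j + M - 1) = x j ^ 2 + (2 * M - 1) * x j + M * (M - 1) :=
    fun j => by ring
  rw [Finset.sum_congr rfl fun j _ => this j, Finset.sum_add_distrib, Finset.sum_add_distrib,
    ← Finset.mul_sum, hx]
  simp

/-- This is nonnegativity of the `e`-weight: runner `j` carries `x_j + M` beads at distinct heights,
whose sum is least when they are pushed to the bottom. -/
theorem sum_sq_residueCount_sub_le (e : ℕ) [NeZero e] (μ : YoungDiagram) :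
    ∑ j : ZMod e, (residueCount e μ j - residueCount e μ (j + 1)) ^ 2 ≤
      2 * residueCount e μ 0 := by
  set M := μ.colLen 0 with hM
  have hN : μ.colLen 0 ≤ e * M := Nat.le_mul_of_pos_left _ (NeZero.pos e)
  have h₀ := residueCount_zero_eq e M μ hN
  have h₁ := residueCount_sub_eq e M μ hN
  have hsum := sum_mul_sub_one_eq _ (sum_residueCount_sub e μ) M
  rw [ZMod.card] at hsum
  rw [← Finset.sum_fiberwise (Finset.range (e * M)) fun a => (bead μ (e * M) a : ZMod e),
    Finset.sum_mul] at h₀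
  have hle : ∑ j : ZMod e, (residueCount e μ j - residueCount e μ (j + 1) + M) *
      (residueCount e μ j - residueCount e μ (j + 1) + M - 1) ≤
      ∑ j : ZMod e, (∑ a ∈ Finset.range (e * M) with (bead μ (e * M) a : ZMod e) = j,
        ((bead μ (e * M) a / e : ℕ) : ℤ)) * 2 := by
    refine Finset.sum_le_sum fun j _ => ?_
    rw [h₁, sub_add_cancel]
    refine card_mul_le_sum_of_injOn _ _ fun a ha b hb hab => ?_
    simp only [Finset.coe_filter, Finset.mem_range, Set.mem_ofPred_eq] at ha hb
    refine bead_injOn μ (e * M) (by simpa using ha.1) (by simpa using hb.1) ?_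
    have hmod : bead μ (e * M) a % e = bead μ (e * M) b % e :=
      (ZMod.natCast_eq_natCast_iff' _ _ _).1 (ha.2.trans hb.2.symm)
    rw [← Nat.div_add_mod (bead μ (e * M) a) e, hmod, hab, Nat.div_add_mod]
  linarith

/-- In increasing order, the `i`-th element minus `i` is nondecreasing; read backwards, these
differences are the row lengths. -/
theorem exists_youngDiagram_of_betaSet (T : Finset ℕ) :
    ∃ μ : YoungDiagram, μ.colLen 0 ≤ T.card ∧
      (Finset.range T.card).image (bead μ T.card) = T := by
  set N := T.card with hN
  let g : Fin N ↪o ℕ := T.orderEmbOfFin rfl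
  let G : ℕ → ℕ := fun i => if h : i < N then g ⟨i, h⟩ else 0
  have hG : ∀ i j, i ≤ j → j < N → G i + (j - i) ≤ G j := by
    intro i j hij
    induction j, hij using Nat.le_induction with
    | base => intro _; simp
    | succ j hij ih =>
      intro hj
      have h := ih (by omega)
      have hlt : G j < G (j + 1) := by
        simp only [G, hj, Nat.lt_of_succ_lt hj, dif_pos]
        exact g.strictMono (by simp)
      omega
  let l : ℕ → ℕ := fun a => if a < N then G (N - 1 - a) - (N - 1 - a) else 0
  have hl : ∀ a b, a ≤ b → l b ≤ l a := by
    intro a b hab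
    by_cases hb : b < N
    · have := hG (N - 1 - b) (N - 1 - a) (by omega) (by omega)
      have ha : a < N := by omega
      simp only [l, hb, ha, if_true]
      omega
    · simp [l, hb]
  let μ : YoungDiagram :=
    { cells := (Finset.range N ×ˢ Finset.range (l 0)).filter fun γ => γ.2 < l γ.1
      isLowerSet := by
        rintro ⟨a, b⟩ ⟨a', b'⟩ h hγ
        simp only [Finset.coe_filter, Finset.mem_product, Finset.mem_range, Set.mem_ofPred_eq,
          Prod.mk_le_mk] at h hγ ⊢
        have h1 := hl a' a h.1
        have h2 := hl 0 a' (Nat.zero_le _)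
        omega }
  have hmem : ∀ a b, (a, b) ∈ μ ↔ b < l a := by
    intro a b
    rw [← YoungDiagram.mem_cells]
    simp only [μ, Finset.mem_filter, Finset.mem_product, Finset.mem_range]
    refine ⟨fun h => h.2, fun h => ⟨⟨?_, h.trans_le (hl 0 a (Nat.zero_le _))⟩, h⟩⟩
    by_contra ha
    simp [l, ha] at h
  have hrow : ∀ a, μ.rowLen a = l a := by
    intro a
    refine eq_of_forall_lt_iff fun b => ?_
    rw [← hmem, YoungDiagram.mem_iff_lt_rowLen]
  refine ⟨μ, ?_, ?_⟩
  · by_contra! h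
    have := (hmem N 0).1 (YoungDiagram.mem_iff_lt_colLen.2 h)
    simp [l] at this
  · refine Finset.eq_of_subset_of_card_le (fun t ht => ?_) ?_
    · obtain ⟨a, ha, rfl⟩ := Finset.mem_image.1 ht
      have ha := Finset.mem_range.1 ha
      have h0 := hG 0 (N - 1 - a) (Nat.zero_le _) (by omega)
      have : bead μ N a = G (N - 1 - a) := by
        simp only [bead, hrow, l, ha, if_true]; omega
      rw [this]
      have hlt : N - 1 - a < N := by omega
      simp only [G, hlt, dif_pos]
      exact T.orderEmbOfFin_mem rfl _
    · rw [Finset.card_image_of_injOn (bead_injOn μ N), Finset.card_range]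

theorem exists_finset_card_sum (c w : ℕ) (h : c = 0 → w = 0) :
    ∃ Q : Finset ℕ, Q.card = c ∧ (∑ q ∈ Q, (q : ℤ)) * 2 = (c : ℤ) * (c - 1) + 2 * w := by
  rcases c with _ | c
  · exact ⟨∅, by simp, by simp [h rfl]⟩
  · have hc : c + w ∉ Finset.range c := by simp
    refine ⟨insert (c + w) (Finset.range c), by simp [Finset.card_insert_of_notMem hc], ?_⟩
    rw [Finset.sum_insert hc]
    have := sum_range_cast_mul_two c
    push_cast
    linear_combination this

/-- Put `x_j + M` beads at the bottom of runner `j`, then raise the top bead of runner `0` by `w`.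
-/
theorem exists_residueCount_eq (e : ℕ) [NeZero e] (x : ZMod e → ℤ) (hx : ∑ j, x j = 0) (w : ℕ) :
    ∃ μ : YoungDiagram, (∀ j, residueCount e μ j - residueCount e μ (j + 1) = x j) ∧
      2 * residueCount e μ 0 = ∑ j, x j ^ 2 + 2 * w := by
  -- Strict positivity ensures that runner `0` has a bead to raise.
  obtain ⟨M, hM⟩ : ∃ M : ℕ, ∀ j, 0 < x j + M := by
    refine ⟨∑ j, (x j).natAbs + 1, fun j => ?_⟩
    have : (x j).natAbs ≤ ∑ j, (x j).natAbs :=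
      Finset.single_le_sum (f := fun j => (x j).natAbs) (fun _ _ => Nat.zero_le _)
        (Finset.mem_univ j)
    omega
  let c : ZMod e → ℕ := fun j => (x j + M).toNat
  have hc : ∀ j, (c j : ℤ) = x j + M := fun j => Int.toNat_of_nonneg (hM j).le
  have hQ := fun j => exists_finset_card_sum (c j) (if j = 0 then w else 0) (fun h => by
    have := hM j; have := hc j; omega)
  choose Q hQc hQs using hQ
  let φ : (Σ _ : ZMod e, ℕ) → ℕ := fun s => e * s.2 + s.1.val
  have hdiv : ∀ s, φ s / e = s.2 := fun s => by
    simp only [φ]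
    rw [Nat.mul_add_div (NeZero.pos e), Nat.div_eq_of_lt s.1.val_lt, add_zero]
  have hmod : ∀ s, ((φ s : ℕ) : ZMod e) = s.1 := fun s => by simp [φ]
  have hφ : Function.Injective φ := by
    rintro ⟨j, q⟩ ⟨j', q'⟩ h
    have h₁ := hdiv ⟨j, q⟩
    have h₂ := hmod ⟨j, q⟩
    rw [h, hdiv] at h₁
    rw [h, hmod] at h₂
    simp only at h₁ h₂
    rw [h₁, h₂]
  let T : Finset ℕ := (Finset.univ.sigma Q).image φ
  have hT : ∀ F : ℕ → ℤ, ∑ t ∈ T, F t = ∑ j, ∑ q ∈ Q j, F (φ ⟨j, q⟩) := fun F => by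
    rw [Finset.sum_image hφ.injOn, Finset.sum_sigma]
  have hcard : T.card = e * M := by
    have h : (T.card : ℤ) = e * M := by
      rw [Finset.card_image_of_injective _ hφ, Finset.card_sigma]
      push_cast
      simp_rw [hQc, hc]
      rw [Finset.sum_add_distrib, hx]
      simp
    exact_mod_cast h
  obtain ⟨μ, hμ, hbead⟩ := exists_youngDiagram_of_betaSet T
  rw [hcard] at hμ hbead
  have hsum : ∀ F : ℕ → ℤ, ∑ a ∈ Finset.range (e * M), F (bead μ (e * M) a) =
      ∑ j, ∑ q ∈ Q j, F (φ ⟨j, q⟩) := fun F => by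
    rw [← hT, ← hbead, Finset.sum_image (bead_injOn μ _)]
  refine ⟨μ, fun j => ?_, ?_⟩
  · rw [residueCount_sub_eq e M μ hμ, Finset.natCast_card_filter,
      hsum fun t => if (t : ZMod e) = j then 1 else 0]
    simp [hmod, hQc, hc]
  · have h := residueCount_zero_eq e M μ hμ
    rw [hsum fun t => ((t / e : ℕ) : ℤ), Finset.sum_mul] at h
    simp_rw [hdiv, hQs, hc] at h
    rw [Finset.sum_add_distrib, sum_mul_sub_one_eq x hx, ZMod.card] at h
    simp only [Nat.cast_ite, Nat.cast_zero, mul_ite, mul_zero, Finset.sum_ite_eq',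
      Finset.mem_univ, if_true] at h
    linarith

/-! ### Contents of multipartitions and orbits of charges. -/

theorem content_apply {e r : ℕ} [NeZero r] (κ : Multicharge e r) (lam : Multipartition r)
    (i : ZMod e) : content κ lam i = ∑ c, residueCount e (lam c) (i - κ c) := by
  have hdisj : Set.PairwiseDisjoint (↑(Finset.univ : Finset (ZMod r)))
      fun c : ZMod r => (lam c).cells ×ˢ {c} := by
    intro c _ c' _ h
    refine Finset.disjoint_left.2 fun γ hγ hγ' => h ?_
    simp only [Finset.mem_product, Finset.mem_singleton] at hγ hγ'
    exact hγ.2.symm.trans hγ'.2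
  rw [content, Finsupp.finsetSum_apply, diagram, Finset.sum_biUnion hdisj]
  refine Finset.sum_congr rfl fun c _ => ?_
  rw [Finset.sum_product, residueCount]
  refine Finset.sum_congr rfl fun γ _ => ?_
  rw [Finset.sum_singleton, simpleRoot, Finsupp.single_apply]
  simp only [residue, eq_sub_iff_add_eq]
  congr

theorem rootShift_apply_add (e η : ℕ) (α : RootLattice e) (i : ZMod e) :
    rootShift e η α (i + η) = α i :=
  Finsupp.mapDomain_apply (add_left_injective (η : ZMod e)) α i

/-- The multiples `η j`, `j < p`, run once through the kernel of reduction from `ℤ/ηpℤ` to `ℤ/ηℤ`.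
-/
theorem sum_residueCount_fold (η p : ℕ) [NeZero η] [NeZero p] (μ : YoungDiagram)
    (i : ZMod (η * p)) :
    ∑ j ∈ Finset.range p, residueCount (η * p) μ (i - ((η * j : ℕ) : ZMod (η * p))) =
      residueCount η μ (ZMod.castHom (dvd_mul_right η p) (ZMod η) i) := by
  simp only [residueCount]
  rw [Finset.sum_comm]
  refine Finset.sum_congr rfl fun γ _ => ?_
  set φ := ZMod.castHom (dvd_mul_right η p) (ZMod η)
  set v : ZMod (η * p) := i - ((γ.2 : ZMod (η * p)) - γ.1) with hv
  have h₁ : ∀ j : ℕ, (γ.2 : ZMod (η * p)) - γ.1 = i - ((η * j : ℕ) : ZMod (η * p)) ↔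
      ((η * j : ℕ) : ZMod (η * p)) = v := fun j =>
    ⟨fun h => by rw [hv, h]; ring, fun h => by rw [h, hv]; ring⟩
  have h₂ : (γ.2 : ZMod η) - γ.1 = φ i ↔ η ∣ v.val := by
    rw [← ZMod.natCast_eq_zero_iff, ← map_natCast φ v.val, ZMod.natCast_zmod_val, hv, map_sub,
      map_sub, map_natCast, map_natCast, sub_eq_zero, eq_comm]
  simp only [h₁, h₂]
  have h₃ : ∀ j ∈ Finset.range p, ((η * j : ℕ) : ZMod (η * p)) = v ↔ η * j = v.val := by
    intro j hj
    have hlt : η * j < η * p := (Nat.mul_lt_mul_left (NeZero.pos η)).2 (Finset.mem_range.1 hj)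
    refine ⟨fun h => by rw [← h, ZMod.val_cast_of_lt hlt], fun h => by rw [h]; simp⟩
  rw [Finset.sum_congr rfl fun j hj => if_congr (h₃ j hj) rfl rfl]
  split_ifs with h
  · obtain ⟨m, hm⟩ := h
    have hmp : m < p := (Nat.mul_lt_mul_left (NeZero.pos η)).1 (hm ▸ v.val_lt)
    rw [Finset.sum_eq_single m]
    · simp [hm]
    · intro j _ hj
      rw [if_neg]
      rw [hm]
      exact fun h => hj (Nat.eq_of_mul_eq_mul_left (NeZero.pos η) h)
    · exact fun h => absurd (Finset.mem_range.2 hmp) h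
  · exact Finset.sum_eq_zero fun j _ => if_neg fun hj => h ⟨j, hj.symm⟩

theorem Compatible.apply_add_mul {e r d η : ℕ} {κ : Multicharge e r} (hκ : Compatible κ d η)
    (c : ZMod r) (s : ℕ) : κ (c + ((d * s : ℕ) : ZMod r)) = κ c + ((η * s : ℕ) : ZMod e) := by
  induction s with
  | zero => simp
  | succ s ih =>
    have h := hκ (c + ((d * s : ℕ) : ZMod r))
    rw [ih] at h
    rw [Nat.mul_succ, Nat.mul_succ, Nat.cast_add, Nat.cast_add, ← add_assoc, ← add_assoc, h]

/-- The components of a compatible multicharge, arranged in `d` orbits of `p` components each; an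
orbit carries the charges `k, k + η, …, k + (p - 1) η` for some `0 ≤ k < η`. -/
theorem Compatible.exists_equiv {d η p : ℕ} [NeZero d] [NeZero η] [NeZero p]
    {κ : Multicharge (η * p) (d * p)} (hκ : Compatible κ d η) :
    ∃ (k : ZMod d → ℕ) (E : ZMod (d * p) ≃ ZMod d × Fin p), (∀ c, k c < η) ∧
      (∀ c, κ c = ((k (E c).1 + η * ((E c).2 : ℕ) : ℕ) : ZMod (η * p))) ∧
      ∀ c, (E (c - (d : ZMod (d * p)))).1 = (E c).1 := by
  set φ := ZMod.castHom (dvd_mul_right d p) (ZMod d) with hφ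
  have hstep : ∀ c c', φ c = φ c' → ∃ s : ℕ, c' = c + ((d * s : ℕ) : ZMod (d * p)) := by
    intro c c' h
    have hlt := c.val_lt
    have hd : d ∣ c'.val + d * p - c.val := by
      rw [← ZMod.natCast_eq_zero_iff, Nat.cast_sub (by omega)]
      rw [← ZMod.natCast_zmod_val c, ← ZMod.natCast_zmod_val c', map_natCast, map_natCast] at h
      simp [h]
    obtain ⟨s, hs⟩ := hd
    refine ⟨s, ?_⟩
    rw [← hs, Nat.cast_sub (by omega)]
    simp
  have hmod : ∀ c c', φ c = φ c' → (κ c).val % η = (κ c').val % η := by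
    intro c c' h
    obtain ⟨s, rfl⟩ := hstep c c' h
    rw [hκ.apply_add_mul, ← ZMod.natCast_eq_natCast_iff']
    set ψ := ZMod.castHom (dvd_mul_right η p) (ZMod η)
    rw [← map_natCast ψ, ← map_natCast ψ, ZMod.natCast_zmod_val, ZMod.natCast_zmod_val, map_add,
      map_natCast]
    simp
  have hlift : ∀ c : ZMod d, φ ((c.val : ℕ) : ZMod (d * p)) = c := fun c => by simp [hφ]
  let f : ZMod (d * p) → ZMod d × Fin p := fun c =>
    (φ c, ⟨(κ c).val / η, Nat.div_lt_of_lt_mul (κ c).val_lt⟩)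
  -- Within an orbit the charges agree modulo `η`, so the quotient by `η` determines the charge;
  -- equal charges force the step `s` to be a multiple of `p`.
  have hinj : Function.Injective f := by
    intro c c' h
    obtain ⟨h₁, h₂⟩ := Prod.ext_iff.1 h
    have h₂ : (κ c).val / η = (κ c').val / η := congrArg Fin.val h₂
    have h₃ : κ c = κ c' := ZMod.val_injective _ (by
      rw [← Nat.div_add_mod (κ c).val η, h₂, hmod c c' h₁, Nat.div_add_mod])
    obtain ⟨s, rfl⟩ := hstep c c' h₁
    rw [hκ.apply_add_mul, left_eq_add, ZMod.natCast_eq_zero_iff] at h₃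
    have hs : p ∣ s := Nat.dvd_of_mul_dvd_mul_left (NeZero.pos η) h₃
    have : ((d * s : ℕ) : ZMod (d * p)) = 0 :=
      (ZMod.natCast_eq_zero_iff _ _).2 (Nat.mul_dvd_mul_left d hs)
    rw [this, add_zero]
  have hbij : Function.Bijective f :=
    (Fintype.bijective_iff_injective_and_card f).2 ⟨hinj, by simp [ZMod.card]⟩
  refine ⟨fun c => (κ ((c.val : ℕ) : ZMod (d * p))).val % η, Equiv.ofBijective f hbij,
    fun c => Nat.mod_lt _ (NeZero.pos η), fun c => ?_, fun c => ?_⟩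
  · simp only [Equiv.ofBijective_apply, f]
    rw [hmod _ c (hlift (φ c)), Nat.mod_add_div, ZMod.natCast_zmod_val]
  · simp [f]

/-! ### Weak duality between the two transport problems. -/

theorem sum_ite_lt_sign (p j : ℕ) (hj : j < p) :
    ∑ m ∈ Finset.range p, (if m < j then (1 : ℤ) else -1) = 2 * j - p := by
  have h : ∀ m, (if m < j then (1 : ℤ) else -1) = 2 * (if m < j then 1 else 0) - 1 := fun m => by
    split_ifs <;> norm_num
  have h' : (Finset.range p).filter (· < j) = Finset.range j := by
    ext m; simp only [Finset.mem_filter, Finset.mem_range]; omega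
  rw [Finset.sum_congr rfl fun m _ => h m, Finset.sum_sub_distrib, ← Finset.mul_sum,
    ← Finset.natCast_card_filter, h']
  simp

theorem sum_ite_gt_sign (p m : ℕ) (hm : m < p) :
    ∑ j ∈ Finset.range p, (if m < j then (1 : ℤ) else -1) = 2 * (p - 1 - m : ℕ) - p := by
  rw [← sum_ite_lt_sign p (p - 1 - m) (by omega), ← Finset.sum_range_reflect]
  refine Finset.sum_congr rfl fun j hj => ?_
  have := Finset.mem_range.1 hj
  congr 1
  rw [eq_iff_iff]
  omega

/-- The signs sum to `2j - p` over `m` and to `2(p - 1 - m) - p` over `j`. The sum thus splits into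
two second moments and the cross term `2πρ`; the reversal `p - 1 - m` is what makes the second
moment fit. -/
theorem sum_potential_sq (π ρ : ℤ) (p : ℕ) (hp : 0 < p) :
    ∑ j ∈ Finset.range p, ∑ m ∈ Finset.range p,
      (((π + j) / p + (ρ + (p - 1 - m : ℕ)) / p) ^ 2 -
        (if m < j then 1 else -1) * ((π + j) / p + (ρ + (p - 1 - m : ℕ)) / p)) =
      (π + ρ) ^ 2 + (π + ρ) := by
  set a : ℕ → ℤ := fun j => (π + j) / p with ha
  set b : ℕ → ℤ := fun m => (ρ + (p - 1 - m : ℕ)) / p with hb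
  have ha₁ : ∑ j ∈ Finset.range p, a j = π := sum_range_add_ediv π p hp
  have hb₁ : ∑ m ∈ Finset.range p, b m = ρ :=
    (Finset.sum_range_reflect (fun j => (ρ + (j : ℤ)) / p) p).trans (sum_range_add_ediv ρ p hp)
  have ha₂ : ∑ j ∈ Finset.range p, ((p : ℤ) * a j ^ 2 - (2 * j - p) * a j) = π ^ 2 + π := by
    rw [← sum_range_add_ediv_sq π p hp]
    exact Finset.sum_congr rfl fun j _ => by ring
  have hb₂ : ∑ m ∈ Finset.range p,
      ((p : ℤ) * b m ^ 2 - (2 * (p - 1 - m : ℕ) - p) * b m) = ρ ^ 2 + ρ := by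
    rw [← sum_range_add_ediv_sq ρ p hp, ← Finset.sum_range_reflect]
    refine Finset.sum_congr rfl fun m hm => ?_
    have hm := Finset.mem_range.1 hm
    have : p - 1 - (p - 1 - m) = m := by omega
    simp only [hb, this]
    ring
  have hexp : ∀ j m : ℕ, (a j + b m) ^ 2 - (if m < j then 1 else -1) * (a j + b m) =
      (a j ^ 2 - (if m < j then 1 else -1) * a j) + 2 * (a j * b m) +
        (b m ^ 2 - (if m < j then 1 else -1) * b m) := fun j m => by ring
  have hA : ∑ j ∈ Finset.range p, ∑ m ∈ Finset.range p,
      (a j ^ 2 - (if m < j then 1 else -1) * a j) = π ^ 2 + π := by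
    rw [← ha₂]
    refine Finset.sum_congr rfl fun j hj => ?_
    rw [Finset.sum_sub_distrib, ← Finset.sum_mul, sum_ite_lt_sign p j (Finset.mem_range.1 hj)]
    simp
  have hB : ∑ j ∈ Finset.range p, ∑ m ∈ Finset.range p,
      (b m ^ 2 - (if m < j then 1 else -1) * b m) = ρ ^ 2 + ρ := by
    rw [← hb₂, Finset.sum_comm]
    refine Finset.sum_congr rfl fun m hm => ?_
    rw [Finset.sum_sub_distrib, ← Finset.sum_mul, sum_ite_gt_sign p m (Finset.mem_range.1 hm)]
    simp
  have hAB : ∑ j ∈ Finset.range p, ∑ m ∈ Finset.range p, 2 * (a j * b m) = 2 * (π * ρ) := by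
    rw [← ha₁, ← hb₁, Finset.sum_mul_sum, Finset.mul_sum]
    simp only [Finset.mul_sum]
  change ∑ j ∈ Finset.range p, ∑ m ∈ Finset.range p,
    ((a j + b m) ^ 2 - (if m < j then 1 else -1) * (a j + b m)) = _
  simp only [hexp]
  simp only [Finset.sum_add_distrib, hA, hB, hAB]
  ring

/-- Weak duality for the transport problem with `p` copies of each row and of each column. -/
theorem sum_mul_sub_one_le {C I : Type*} [Fintype C] [Fintype I] (p : ℕ) (hp : 0 < p)
    (k : C → ℤ) (Z : I → ℤ) (z : C → I → ℤ) (π : C → ℤ) (ρ : I → ℤ)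
    (hzk : ∀ c, ∑ i, z c i = k c) (hzZ : ∀ i, ∑ c, z c i = Z i)
    (hz : ∀ c i, z c i = π c + ρ i ∨ z c i = π c + ρ i + 1) (u : C → ℕ → I → ℕ → ℤ)
    (huk : ∀ c, ∀ j < p, ∑ i, ∑ m ∈ Finset.range p, u c j i m = k c)
    (huZ : ∀ i, ∀ m < p, ∑ c, ∑ j ∈ Finset.range p, u c j i m = Z i) :
    ∑ c, ∑ i, z c i * (z c i - 1) ≤ ∑ c, ∑ j ∈ Finset.range p, ∑ i, ∑ m ∈ Finset.range p,
      (u c j i m ^ 2 + (if m < j then 1 else -1) * u c j i m) := by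
  set a : C → ℕ → ℤ := fun c j => (π c + j) / p with ha
  set b : I → ℕ → ℤ := fun i m => (ρ i + (p - 1 - m : ℕ)) / p with hb
  have ha₁ : ∀ c, ∑ j ∈ Finset.range p, a c j = π c := fun c => sum_range_add_ediv (π c) p hp
  have hb₁ : ∀ i, ∑ m ∈ Finset.range p, b i m = ρ i := fun i =>
    (Finset.sum_range_reflect (fun j => (ρ i + (j : ℤ)) / p) p).trans
      (sum_range_add_ediv (ρ i) p hp)
  -- The two sides differ by `D² ± D` with `D = u - a - b` an integer, hence nonnegative.
  have hpt : ∀ c j i m, 2 * (a c j * u c j i m) + 2 * (b i m * u c j i m) -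
      ((a c j + b i m) ^ 2 - (if m < j then 1 else -1) * (a c j + b i m)) ≤
      u c j i m ^ 2 + (if m < j then 1 else -1) * u c j i m := by
    intro c j i m
    generalize a c j = A
    generalize b i m = B
    generalize u c j i m = U
    have h₁ : 0 ≤ (U - (A + B)) * (U - (A + B) + 1) := by
      rcases le_or_gt 0 (U - (A + B)) with h | h <;> nlinarith
    have h₂ : 0 ≤ (U - (A + B)) * (U - (A + B) - 1) := by
      rcases le_or_gt (U - (A + B)) 0 with h | h <;> nlinarith
    split_ifs <;> nlinarith
  refine le_trans (le_of_eq ?_) (Finset.sum_le_sum fun c _ => Finset.sum_le_sum fun j _ =>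
    Finset.sum_le_sum fun i _ => Finset.sum_le_sum fun m _ => hpt c j i m)
  have hA : ∑ c, ∑ j ∈ Finset.range p, ∑ i, ∑ m ∈ Finset.range p, 2 * (a c j * u c j i m) =
      2 * ∑ c, π c * k c := by
    rw [Finset.mul_sum]
    refine Finset.sum_congr rfl fun c _ => ?_
    rw [← ha₁, Finset.sum_mul, Finset.mul_sum]
    refine Finset.sum_congr rfl fun j hj => ?_
    rw [← huk c j (Finset.mem_range.1 hj)]
    simp only [Finset.mul_sum]
  have hB : ∑ c, ∑ j ∈ Finset.range p, ∑ i, ∑ m ∈ Finset.range p, 2 * (b i m * u c j i m) =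
      2 * ∑ i, ρ i * Z i := by
    have hcomm : ∀ c, ∑ j ∈ Finset.range p, ∑ i, ∑ m ∈ Finset.range p, 2 * (b i m * u c j i m) =
        ∑ i, ∑ m ∈ Finset.range p, ∑ j ∈ Finset.range p, 2 * (b i m * u c j i m) := fun c => by
      rw [Finset.sum_comm]
      exact Finset.sum_congr rfl fun i _ => Finset.sum_comm
    simp only [hcomm]
    rw [Finset.sum_comm, Finset.mul_sum]
    refine Finset.sum_congr rfl fun i _ => ?_
    rw [Finset.sum_comm, ← hb₁, Finset.sum_mul, Finset.mul_sum]
    refine Finset.sum_congr rfl fun m hm => ?_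
    rw [← huZ i m (Finset.mem_range.1 hm)]
    simp only [Finset.mul_sum]
  have hT : ∑ c, ∑ j ∈ Finset.range p, ∑ i, ∑ m ∈ Finset.range p,
      ((a c j + b i m) ^ 2 - (if m < j then 1 else -1) * (a c j + b i m)) =
      ∑ c, ∑ i, ((π c + ρ i) ^ 2 + (π c + ρ i)) := by
    refine Finset.sum_congr rfl fun c _ => ?_
    rw [Finset.sum_comm]
    exact Finset.sum_congr rfl fun i _ => sum_potential_sq (π c) (ρ i) p hp
  -- Complementary slackness: equality holds because `z - π - ρ` is `0` or `1`.
  have hz' : ∀ c i, z c i * (z c i - 1) =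
      2 * (π c * z c i) + 2 * (ρ i * z c i) - ((π c + ρ i) ^ 2 + (π c + ρ i)) := by
    intro c i
    rcases hz c i with h | h <;> rw [h] <;> ring
  have hzA : ∑ c, ∑ i, 2 * (π c * z c i) = 2 * ∑ c, π c * k c := by
    simp only [← hzk, Finset.mul_sum]
  have hzB : ∑ c, ∑ i, 2 * (ρ i * z c i) = 2 * ∑ i, ρ i * Z i := by
    rw [Finset.sum_comm]
    simp only [← hzZ, Finset.mul_sum]
  simp only [hz', Finset.sum_sub_distrib, Finset.sum_add_distrib, hA, hB, hzA, hzB]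
  simp only [Finset.sum_sub_distrib, Finset.sum_add_distrib] at hT
  rw [hT]

/-! ### The matrix attached to the given multipartition. -/

theorem sum_zmod_val (η : ℕ) [NeZero η] (f : ℕ → ℤ) :
    ∑ i : ZMod η, f i.val = ∑ a ∈ Finset.range η, f a := by
  rw [sum_zmod_eq_sum_range]
  exact Finset.sum_congr rfl fun a ha => by rw [ZMod.val_cast_of_lt (Finset.mem_range.1 ha)]

theorem sum_zmod_ite_val_lt (η k : ℕ) [NeZero η] (hk : k ≤ η) (f : ℕ → ℤ) :
    ∑ i : ZMod η, (if i.val < k then f i.val else 0) = ∑ a ∈ Finset.range k, f a := by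
  rw [sum_zmod_val η fun a => if a < k then f a else 0, ← Finset.sum_filter]
  refine Finset.sum_congr ?_ fun _ _ => rfl
  ext a
  simp only [Finset.mem_filter, Finset.mem_range]
  omega

theorem sum_zmod_mul_add_val (η p : ℕ) [NeZero η] (f : ℕ → ℤ) :
    ∑ i : ZMod η, ∑ m ∈ Finset.range p, f (η * m + i.val) =
      ∑ n ∈ Finset.range (η * p), f n := by
  rw [sum_range_mul, Finset.sum_comm]
  exact Finset.sum_congr rfl fun m _ => sum_zmod_val η fun a => f (η * m + a)

theorem mul_add_lt_mul_add_iff {η m i j k : ℕ} (hi : i < η) (hk : k < η) :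
    η * m + i < η * j + k ↔ m < j ∨ m = j ∧ i < k := by
  rcases lt_trichotomy m j with h | rfl | h
  · have := Nat.mul_le_mul_left η (Nat.succ_le_of_lt h)
    rw [Nat.mul_succ] at this
    exact ⟨fun _ => Or.inl h, fun _ => by omega⟩
  · simp
  · have := Nat.mul_le_mul_left η (Nat.succ_le_of_lt h)
    rw [Nat.mul_succ] at this
    exact ⟨fun _ => by omega, fun h' => by omega⟩

theorem sum_range_residueCount_sub (e : ℕ) (μ : YoungDiagram) (i : ZMod e) (n : ℕ) :
    ∑ a ∈ Finset.range n, (residueCount e μ (a + i) - residueCount e μ (a + i + 1)) =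
      residueCount e μ i - residueCount e μ (n + i) := by
  have h := Finset.sum_range_sub' (fun a : ℕ => residueCount e μ (a + i)) n
  simp only [Nat.cast_zero, zero_add] at h
  rw [← h]
  refine Finset.sum_congr rfl fun a _ => ?_
  push_cast
  rw [add_right_comm]

section Row

variable (η p k j : ℕ) [NeZero η] (μ : YoungDiagram)

/-- The differences of consecutive residue multiplicities of a Young diagram of charge
`k + η * j`, corrected by the indicator function of the interval `[η * j, η * j + k)`. -/
def chargeRow (i : ZMod η) (m : ℕ) : ℤ :=
  residueCount (η * p) μ (((η * m + i.val : ℕ) : ZMod (η * p)) - ((k + η * j : ℕ) : ZMod (η * p))) -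
    residueCount (η * p) μ
      (((η * m + i.val : ℕ) : ZMod (η * p)) - ((k + η * j : ℕ) : ZMod (η * p)) + 1) +
    if m = j ∧ i.val < k then 1 else 0

theorem sum_chargeRow_eq (hk : k < η) (hj : j < p) :
    ∑ i : ZMod η, ∑ m ∈ Finset.range p, chargeRow η p k j μ i m = k := by
  simp only [chargeRow, Finset.sum_add_distrib]
  rw [sum_zmod_mul_add_val η p fun n =>
    residueCount (η * p) μ ((n : ZMod (η * p)) - ((k + η * j : ℕ) : ZMod (η * p))) -
    residueCount (η * p) μ ((n : ZMod (η * p)) - ((k + η * j : ℕ) : ZMod (η * p)) + 1)]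
  simp only [sub_eq_add_neg (_ : ZMod (η * p)), sum_range_residueCount_sub]
  have h : ∀ i : ZMod η, ∑ m ∈ Finset.range p, (if m = j ∧ i.val < k then (1 : ℤ) else 0) =
      if i.val < k then 1 else 0 := by
    intro i
    by_cases hi : i.val < k <;> simp [hi, hj]
  simp only [h]
  rw [sum_zmod_ite_val_lt η k hk.le fun _ => 1]
  simp

/-- Correcting the differences by the whole indicator of `n < k + η j` would give entries `y` of
cost `y (y - 1)`. Omitting the full blocks `m < j` replaces `y` by `u = y - 1` there, so the cost
becomes `u (u + 1)`. This is the source of the sign, and it makes the row sum independent of `j`. -/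
theorem sum_chargeRow_sq_le [NeZero p] (hk : k < η) (hj : j < p) :
    ∑ i : ZMod η, ∑ m ∈ Finset.range p, (chargeRow η p k j μ i m ^ 2 +
      (if m < j then 1 else -1) * chargeRow η p k j μ i m) ≤
      2 * residueCount (η * p) μ (-((k + η * j : ℕ) : ZMod (η * p))) := by
  set K : ℕ := k + η * j with hK
  set x : ℕ → ℤ := fun n => residueCount (η * p) μ ((n : ZMod (η * p)) + -(K : ZMod (η * p))) -
    residueCount (η * p) μ ((n : ZMod (η * p)) + -(K : ZMod (η * p)) + 1) with hx
  have hKe : K ≤ η * p := by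
    have := Nat.mul_le_mul_left η (Nat.succ_le_of_lt hj)
    rw [Nat.mul_succ] at this
    omega
  have hpt : ∀ (i : ZMod η) (m : ℕ), chargeRow η p k j μ i m ^ 2 +
      (if m < j then 1 else -1) * chargeRow η p k j μ i m =
      x (η * m + i.val) ^ 2 - x (η * m + i.val) +
        2 * if η * m + i.val < K then x (η * m + i.val) else 0 := by
    intro i m
    have hlt : η * m + i.val < K ↔ m < j ∨ m = j ∧ i.val < k := by
      rw [hK, add_comm k, mul_add_lt_mul_add_iff i.val_lt hk]
    have hrow : chargeRow η p k j μ i m =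
        x (η * m + i.val) + if m = j ∧ i.val < k then 1 else 0 := by
      simp only [chargeRow, hx, sub_eq_add_neg (_ : ZMod (η * p))]
      rfl
    rw [hrow]
    simp only [hlt]
    by_cases h₁ : m < j
    · have h₂ : ¬ (m = j ∧ i.val < k) := by omega
      simp only [h₁, h₂, if_true, if_false, true_or]; ring
    · by_cases h₂ : m = j ∧ i.val < k
      · simp only [h₂, if_true, if_false, and_self, or_true, lt_irrefl]; ring
      · simp only [h₁, h₂, if_false, or_false]; ring
  have htot : ∑ n ∈ Finset.range (η * p), x n = 0 := by
    rw [hx, sum_range_residueCount_sub]; simp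
  have hsq : ∑ n ∈ Finset.range (η * p), x n ^ 2 ≤ 2 * residueCount (η * p) μ 0 := by
    refine le_trans (le_of_eq ?_) (sum_sq_residueCount_sub_le (η * p) μ)
    rw [← Equiv.sum_comp (Equiv.addRight (-(K : ZMod (η * p)))), sum_zmod_eq_sum_range]
    rfl
  have hpart : ∑ n ∈ Finset.range (η * p), (if n < K then x n else 0) =
      residueCount (η * p) μ (-(K : ZMod (η * p))) - residueCount (η * p) μ 0 := by
    rw [← Finset.sum_filter]
    have : (Finset.range (η * p)).filter (· < K) = Finset.range K := by
      ext n; simp only [Finset.mem_filter, Finset.mem_range]; omega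
    rw [this, hx, sum_range_residueCount_sub, add_neg_cancel]
  simp only [hpt]
  rw [sum_zmod_mul_add_val η p fun n => x n ^ 2 - x n + 2 * if n < K then x n else 0,
    Finset.sum_add_distrib, Finset.sum_sub_distrib, ← Finset.mul_sum, htot, hpart]
  linarith

end Row

/-! ### Construction of the invariant multipartition. -/

theorem exists_family_residueCount {C : Type*} [Fintype C] [Nonempty C] [DecidableEq C]
    (η : ℕ) [NeZero η] (k : C → ℕ) (hk : ∀ c, k c < η) (z : C → ZMod η → ℤ)
    (hz : ∀ c, ∑ i, z c i = k c) (N : ℤ) (hN : ∑ c, ∑ i, z c i * (z c i - 1) ≤ 2 * N) :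
    ∃ μ : C → YoungDiagram, ∑ c, residueCount η (μ c) (0 - k c) = N ∧
      ∀ i, ∑ c, residueCount η (μ c) (i - k c) - ∑ c, residueCount η (μ c) (i + 1 - k c) =
        ∑ c, z c i - ∑ c, if i.val < k c then 1 else 0 := by
  obtain ⟨c₀⟩ := ‹Nonempty C›
  obtain ⟨S, hS⟩ : (2 : ℤ) ∣ ∑ c, ∑ i, z c i * (z c i - 1) :=
    Finset.dvd_sum fun c _ => Finset.dvd_sum fun i _ => (Int.even_mul_pred_self _).two_dvd
  -- The slack in the cost bound becomes the weight of the single component `c₀`.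
  obtain ⟨w, hw⟩ : ∃ w : ℕ, (w : ℤ) = N - S := ⟨(N - S).toNat, Int.toNat_of_nonneg (by omega)⟩
  let x : C → ZMod η → ℤ := fun c i => z c i - if i.val < k c then 1 else 0
  have hind : ∀ c, ∑ i : ZMod η, (if i.val < k c then (1 : ℤ) else 0) = k c := fun c => by
    rw [sum_zmod_ite_val_lt η (k c) (hk c).le fun _ => 1]; simp
  have hx : ∀ c, ∑ i, x c (i + k c) = 0 := fun c => by
    refine (Equiv.sum_comp (Equiv.addRight (k c : ZMod η)) (x c)).trans ?_
    rw [Finset.sum_sub_distrib, hind, hz, sub_self]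
  have hμ := fun c => exists_residueCount_eq η _ (hx c) (if c = c₀ then w else 0)
  choose μ hμx hμ₀ using hμ
  have hdiff : ∀ c i, residueCount η (μ c) (i - k c) - residueCount η (μ c) (i - k c + 1) =
      x c i := fun c i => by rw [hμx, sub_add_cancel]
  refine ⟨μ, ?_, fun i => ?_⟩
  · have hrow : ∀ c, 2 * residueCount η (μ c) (0 - k c) =
        ∑ i, z c i * (z c i - 1) + 2 * (if c = c₀ then (w : ℤ) else 0) := by
      intro c
      have h₁ := sum_range_residueCount_sub η (μ c) (-(k c : ZMod η)) (k c)
      have h₂ : ∑ a ∈ Finset.range (k c), (residueCount η (μ c) (a + -(k c : ZMod η)) -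
          residueCount η (μ c) (a + -(k c : ZMod η) + 1)) =
          ∑ i : ZMod η, if i.val < k c then x c i else 0 := by
        have h := sum_zmod_ite_val_lt η (k c) (hk c).le fun a => x c a
        simp only [ZMod.natCast_zmod_val] at h
        rw [h]
        exact Finset.sum_congr rfl fun a _ => by rw [← sub_eq_add_neg, hdiff]
      have h₃ : ∑ i, x c (i + k c) ^ 2 = ∑ i, x c i ^ 2 :=
        Equiv.sum_comp (Equiv.addRight (k c : ZMod η)) fun i => x c i ^ 2
      have h₄ : ∑ i, x c i ^ 2 + 2 * ∑ i : ZMod η, (if i.val < k c then x c i else 0) =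
          ∑ i, z c i * (z c i - 1) := by
        have h₅ : ∑ i, z c i * (z c i - 1) = ∑ i, (z c i ^ 2 - if i.val < k c then 1 else 0) := by
          rw [Finset.sum_sub_distrib, hind, ← hz, ← Finset.sum_sub_distrib]
          exact Finset.sum_congr rfl fun i _ => by ring
        rw [h₅, Finset.mul_sum, ← Finset.sum_add_distrib]
        refine Finset.sum_congr rfl fun i _ => ?_
        simp only [x]
        split_ifs <;> ring
      rw [h₂, add_neg_cancel] at h₁
      have h₀ := hμ₀ c
      rw [h₃] at h₀
      push_cast at h₀
      rw [zero_sub]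
      linarith
    have hsum := Finset.sum_congr (rfl : (Finset.univ : Finset C) = _) fun c _ => hrow c
    rw [← Finset.mul_sum, Finset.sum_add_distrib, hS, ← Finset.mul_sum, Finset.sum_ite_eq',
      if_pos (Finset.mem_univ _), hw] at hsum
    linarith
  · rw [← Finset.sum_sub_distrib, ← Finset.sum_sub_distrib]
    exact Finset.sum_congr rfl fun c _ => by rw [← sub_add_eq_add_sub, hdiff]

theorem eq_of_sub_eq {f g : ℕ → ℤ} (h₀ : f 0 = g 0) (h : ∀ n, f n - f (n + 1) = g n - g (n + 1))
    (n : ℕ) : f n = g n := by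
  induction n with
  | zero => exact h₀
  | succ n ih => have := h n; omega

theorem exists_componentShift_eq {d η p : ℕ} [NeZero d] [NeZero η] [NeZero p]
    (κ : Multicharge (η * p) (d * p)) (hκ : Compatible κ d η) (lam : Multipartition (d * p))
    (hfix : rootShift (η * p) η (content κ lam) = content κ lam) :
    ∃ mu : Multipartition (d * p), content κ mu = content κ lam ∧ componentShift d mu = mu := by
  obtain ⟨k, E, hk, hE, hEd⟩ := hκ.exists_equiv
  set A : ℕ → ℤ := fun n => content κ lam (n : ZMod (η * p)) with hA
  have hper : ∀ n m, A (η * m + n) = A n := by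
    intro n m
    induction m with
    | zero => simp
    | succ m ih =>
      rw [← ih]
      simp only [hA]
      have h := rootShift_apply_add (η * p) η (content κ lam) ((η * m + n : ℕ) : ZMod (η * p))
      rw [hfix] at h
      rw [← h]
      push_cast
      ring_nf
  have hsumE : ∀ f : ZMod d → ℕ → ℤ, ∑ c, f (E c).1 (E c).2 =
      ∑ c, ∑ j ∈ Finset.range p, f c j := by
    intro f
    rw [Equiv.sum_comp E fun s => f s.1 s.2, Fintype.sum_prod_type]
    exact Finset.sum_congr rfl fun c _ => (Finset.sum_range (f c)).symm
  let Z : ZMod η → ℤ := fun i =>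
    (A i.val - A (i.val + 1)) + ∑ c, if i.val < k c then (1 : ℤ) else 0
  have hkZ : ∑ c, (k c : ℤ) = ∑ i, Z i := by
    have hAη := hper 0 1
    rw [mul_one, add_zero] at hAη
    rw [Finset.sum_add_distrib, sum_zmod_val η fun n => A n - A (n + 1),
      Finset.sum_range_sub', hAη, sub_self, zero_add, Finset.sum_comm]
    refine Finset.sum_congr rfl fun c _ => ?_
    rw [sum_zmod_ite_val_lt η (k c) (hk c).le fun _ => 1]
    simp
  obtain ⟨z, π, ρ, hzk, hzZ, hz⟩ := exists_matrix_potentials (fun c => (k c : ℤ)) Z hkZ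
  -- The value `⊥` is a filler: only `j < p` occurs in the sums.
  let lam' : ZMod d → ℕ → YoungDiagram := fun c j =>
    if h : j < p then lam (E.symm (c, ⟨j, h⟩)) else ⊥
  have hlam' : ∀ c, lam c = lam' (E c).1 (E c).2 := fun c => by simp [lam']
  have hcontent : ∀ i, content κ lam i = ∑ c, ∑ j ∈ Finset.range p,
      residueCount (η * p) (lam' c j) (i - ((k c + η * j : ℕ) : ZMod (η * p))) := by
    intro i
    rw [content_apply, ← hsumE fun c j =>
      residueCount (η * p) (lam' c j) (i - ((k c + η * j : ℕ) : ZMod (η * p)))]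
    exact Finset.sum_congr rfl fun c _ => by rw [← hlam', ← hE]
  have hbound : ∑ c, ∑ i, z c i * (z c i - 1) ≤ 2 * A 0 := by
    refine (sum_mul_sub_one_le p (NeZero.pos p) _ Z z π ρ hzk hzZ hz
      (fun c j i m => chargeRow η p (k c) j (lam' c j) i m)
      (fun c j hj => sum_chargeRow_eq η p (k c) j _ (hk c) hj) fun i m hm => ?_).trans ?_
    · have h₁ := hper i.val m
      have h₂ := hper (i.val + 1) m
      have hind : ∀ c, ∑ j ∈ Finset.range p, (if m = j ∧ i.val < k c then (1 : ℤ) else 0) =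
          if i.val < k c then 1 else 0 := by
        intro c
        by_cases hi : i.val < k c <;> simp [hi, hm]
      simp only [chargeRow, Finset.sum_add_distrib, Finset.sum_sub_distrib, hind, Z]
      rw [← h₁, ← h₂]
      simp only [hA, hcontent]
      congr 2
      refine Finset.sum_congr rfl fun c _ => Finset.sum_congr rfl fun j _ => ?_
      congr 1
      push_cast
      ring
    · simp only [hA, hcontent, Finset.mul_sum]
      refine Finset.sum_le_sum fun c _ => Finset.sum_le_sum fun j hj => ?_
      have := sum_chargeRow_sq_le η p (k c) j (lam' c j) (hk c) (Finset.mem_range.1 hj)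
      simpa using this
  obtain ⟨μ, hμ₀, hμ⟩ := exists_family_residueCount η k hk z hzk (A 0) hbound
  refine ⟨fun c => μ (E c).1, ?_, funext fun c => congrArg μ (hEd c)⟩
  ext i
  have hmu : content κ (fun c => μ (E c).1) i =
      ∑ c, residueCount η (μ c) (ZMod.castHom (dvd_mul_right η p) (ZMod η) i - k c) := by
    rw [content_apply]
    have h : ∀ c, residueCount (η * p) (μ (E c).1) (i - κ c) = residueCount (η * p) (μ (E c).1)
        (i - ((k (E c).1 + η * ((E c).2 : ℕ) : ℕ) : ZMod (η * p))) := fun c => by rw [hE c]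
    rw [Finset.sum_congr rfl fun c _ => h c, hsumE fun c j =>
      residueCount (η * p) (μ c) (i - ((k c + η * j : ℕ) : ZMod (η * p)))]
    refine Finset.sum_congr rfl fun c _ => ?_
    have h' := sum_residueCount_fold η p (μ c) (i - (k c : ZMod (η * p)))
    rw [map_sub, map_natCast] at h'
    rw [← h']
    refine Finset.sum_congr rfl fun j _ => ?_
    rw [Nat.cast_add, sub_sub]
  rw [hmu, ← ZMod.natCast_zmod_val i, map_natCast]
  -- The two contents agree at `0` and have equal consecutive differences, by the column sums of `z`
  -- and the periodicity of `A`.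
  refine eq_of_sub_eq (f := fun n => ∑ c, residueCount η (μ c) ((n : ZMod η) - k c)) (g := A)
    (by simpa using hμ₀) (fun n => ?_) i.val
  have h := hμ (n : ZMod η)
  rw [hzZ, add_sub_cancel_right, ZMod.val_natCast] at h
  have h₁ := hper (n % η) (n / η)
  have h₂ := hper (n % η + 1) (n / η)
  rw [Nat.div_add_mod] at h₁
  rw [← add_assoc, Nat.div_add_mod] at h₂
  rw [h₁, h₂, ← h]
  push_cast
  rfl

end Stuttering

theorem mainTheorem1 (e r d η p : ℕ) [NeZero r] (hd : 0 < d) (hη : 0 < η) (hp : 0 < p)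
    (he2 : 2 ≤ e) (he : e = η * p) (hr : r = d * p)
    (κ : Stuttering.Multicharge e r) (hκ : Stuttering.Compatible κ d η)
    (lam : Stuttering.Multipartition r)
    (hfix : Stuttering.rootShift e η (Stuttering.content κ lam) = Stuttering.content κ lam) :
    ∃ mu : Stuttering.Multipartition r,
      Stuttering.content κ mu = Stuttering.content κ lam ∧
        Stuttering.componentShift d mu = mu := by
  subst he hr
  have : NeZero d := ⟨hd.ne'⟩
  have : NeZero η := ⟨hη.ne'⟩
  have : NeZero p := ⟨hp.ne'⟩
  exact Stuttering.exists_componentShift_eq κ hκ lam hfix
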